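/- Let $d\ge 1$, $L,\sigma\ge 0$ and $B\in\mathbb R$, and put $r_n=n^{-1/(1+d\log 2)}\log n$. *Model.* $m:[0,1]^d\to\mathbb R$ is $L$-Lipschitz for the Euclidean norm, with $|m|\le B$ on $[0,1]^d$, and $(X_i,Y_i)_{i\le n}$ is an i.i.d. sample of size $n\ge 2$ from $Y=m(X)+\varepsilon$, where $X$ is uniform on $[0,1]^d$ and $\varepsilon\sim\mathcal N(0,\sigma^2)$ is independent of $X$. *Trees.* A tree of depth $k$ starts from the cell $[0,1]^d$ and splits, $k$ times, every current cell at the midpoint of its side in some coordinate (points on the splitting hyperplane go to the lower half). In a *simplified directional* tree one coordinate, uniform on $\{1,\dots,d\}$, is drawn for each of the $k$ levels, independently over levels, and all cells of that level are split along it; in a *centered* tree an independent uniform coordinate is drawn for each cell separately. The trees $\Theta_1,\Theta_2,\dots$ of a forest are independent copies. For $x\in[0,1]^d$ let $A_{\Theta_j}(x)$ be the depth-$k$ cell of the $j$-th tree that contains $x$, let $N_{\Theta_j}(x)=\#\{i: X_i\in A_{\Theta_j}(x)\}$, and let $$\tilde m_{M,n}(x)=\frac{\sum_{j=1}^M\sum_{i=1}^n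 Y_i\mathbf 1_{X_i\in A_{\Theta_j}(x)}}{\sum_{j=1}^M N_{\Theta_j}(x)}\quad(0/0:=0),\qquad \tilde m_{\infty,n}(x)=\lim_{M\to\infty}\tilde m_{M,n}(x),$$ the finite and the infinite KeRF estimators. *Claim.* There is a constant $C>0$, depending only on $d,L,\sigma,B$, such that for all such $m$, all $n\ge 2$ and all such samples and forests the following hold. 1. For every depth $k\ge 0$, almost surely, for all $x\in[0,1]^d$, the limits defining the infinite simplified directional KeRF and the infinite centered KeRF exist, and these two estimators coincide at $x$. 2. If the depth $k\in\mathbb N$ satisfies $\left|k-\frac{d\log n}{1+d\log 2}\right|\le 1$, then the infinite simplified directional KeRF $\tilde m_{\infty,n}$ satisfies, for every $x\in[0,1]^d$, $$\mathbb E\big[(\tilde m_{\infty,n}(x)-m(x))^2\big]\le C\,r_n=C\,n^{-1/(1+d\log 2)}\log n .$$ -/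

import Mathlib

open MeasureTheory ProbabilityTheory Filter Topology

noncomputable section

/-- The unit cube `[0,1]^d` in Euclidean space. -/
def unitCube (d : ℕ) : Set (EuclideanSpace ℝ (Fin d)) :=
  {x | ∀ j, 0 ≤ x j ∧ x j ≤ 1}

/-- A (fully grown, infinite) binary tree of midpoint splits: a node is addressed by the list of
left (`false`) and right (`true`) turns leading to it from the root, the *latest* turn being the
head of the list, and `c v` is the coordinate along which the node `v` is split. -/
abbrev SplitTree (d : ℕ) : Type := List Bool → Fin d

/-- Lower and upper corners of the box at a node: the root is `[0,1]^d`, and a node `v` is split at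
the midpoint of its side in the coordinate `c v`. -/
def nodeCorners {d : ℕ} (c : SplitTree d) : List Bool → (Fin d → ℝ) × (Fin d → ℝ)
  | [] => (fun _ => 0, fun _ => 1)
  | right :: v =>
    let lo := (nodeCorners c v).1
    let hi := (nodeCorners c v).2
    let mid := (lo (c v) + hi (c v)) / 2
    if right then (Function.update lo (c v) mid, hi) else (lo, Function.update hi (c v) mid)

/-- The midpoint at which the node `v` is split (in the coordinate `c v`). -/
def splitPoint {d : ℕ} (c : SplitTree d) (v : List Bool) : ℝ :=
  ((nodeCorners c v).1 (c v) + (nodeCorners c v).2 (c v)) / 2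

/-- The cell at a node. Points on a splitting hyperplane go to the left child, so that the cells of
each level partition `[0,1]^d`. -/
def nodeCell {d : ℕ} (c : SplitTree d) : List Bool → Set (EuclideanSpace ℝ (Fin d))
  | [] => unitCube d
  | right :: v =>
    nodeCell c v ∩ (if right then {x | splitPoint c v < x (c v)} else {x | x (c v) ≤ splitPoint c v})

/-- `A(x)`: the cell of level `k` (one of the `2 ^ k` leaves of the tree grown to depth `k`) that
contains `x`. -/
def leafCell {d : ℕ} (c : SplitTree d) (k : ℕ) (x : EuclideanSpace ℝ (Fin d)) :
    Set (EuclideanSpace ℝ (Fin d)) :=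
  {z | ∃ v : List Bool, v.length = k ∧ x ∈ nodeCell c v ∧ z ∈ nodeCell c v}

/-- The tree of the simplified directional algorithm: one coordinate `θ l` is chosen for each level
`l`, and all nodes of that level are split along it. -/
def directionalTree {d : ℕ} (θ : ℕ → Fin d) : SplitTree d := fun v => θ v.length

/-- `N(x)`: the number of sample points in the cell of `x`. -/
def leafCount {d n : ℕ} (c : SplitTree d) (k : ℕ) (X : Fin n → EuclideanSpace ℝ (Fin d))
    (x : EuclideanSpace ℝ (Fin d)) : ℝ :=
  ∑ i, (leafCell c k x).indicator (fun _ => (1 : ℝ)) (X i)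

/-- The KeRF estimator at `x` built from the first `M` trees of a sequence of trees, grown to depth
`k`, and the sample `(X i, Y i)`. It is `0` if no sample point shares a cell with `x`. -/
def finiteKeRF {d n : ℕ} (M : ℕ) (T : ℕ → SplitTree d) (k : ℕ)
    (X : Fin n → EuclideanSpace ℝ (Fin d)) (Y : Fin n → ℝ) (x : EuclideanSpace ℝ (Fin d)) : ℝ :=
  (∑ j ∈ Finset.range M, ∑ i, Y i * (leafCell (T j) k x).indicator (fun _ => (1 : ℝ)) (X i)) /
    ∑ j ∈ Finset.range M, leafCount (T j) k X x

/-- The infinite KeRF estimator: the limit of the finite ones as the number of trees grows. -/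
def infiniteKeRF {d n : ℕ} (T : ℕ → SplitTree d) (k : ℕ)
    (X : Fin n → EuclideanSpace ℝ (Fin d)) (Y : Fin n → ℝ) (x : EuclideanSpace ℝ (Fin d)) : ℝ :=
  limUnder atTop (fun M : ℕ => finiteKeRF M T k X Y x)

/-- The random coordinates `Θ i` are independent and uniform on `{1, …, d}`. -/
structure IsIIDUniformCoords {Ω : Type*} [MeasurableSpace Ω] (P : Measure Ω) {d : ℕ} {ι : Type*}
    (Θ : ι → Ω → Fin d) : Prop where
  law : ∀ i, HasLaw (Θ i) (uniformOn Set.univ) P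
  indep : iIndepFun Θ P

/-- `(X i, Y i)` is an i.i.d. sample from the model `Y = m(X) + ε`, where `X` is uniform on the unit
cube and `ε ∼ N(0, σ²)` is independent of `X`. -/
structure IsRegressionSample {Ω : Type*} [MeasurableSpace Ω] (P : Measure Ω) {d n : ℕ}
    (m : EuclideanSpace ℝ (Fin d) → ℝ) (σ : NNReal)
    (X : Fin n → Ω → EuclideanSpace ℝ (Fin d)) (ε Y : Fin n → Ω → ℝ) : Prop where
  law_X : ∀ i, HasLaw (X i) (volume.restrict (unitCube d)) P
  law_noise : ∀ i, HasLaw (ε i) (gaussianReal 0 (σ ^ 2)) P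
  indep_noise : ∀ i, IndepFun (X i) (ε i) P
  indep : iIndepFun (fun i ω => (X i ω, ε i ω)) P
  eq_Y : ∀ i, ∀ᵐ ω ∂P, Y i ω = m (X i ω) + ε i ω

end

noncomputable section

/-! The cell of `x` depends only on the coordinates chosen at the `k` nodes on the path of `x`.
These nodes have distinct levels, so in a centered tree, just as in a directional one, the choices
are independent and uniform: each sequence in `Fin k → Fin d` has probability `d ^ (-k)`. By the
strong law both forests therefore have the same limit, the weighted average of the `Y i` with
weights proportional to `kerfKernel k x (X i)` (`HasUniformPaths.tendsto_finiteKeRF`). There are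
only countably many possible paths, so one null set serves all `x`.

For the risk, every cell has volume `2 ^ (-k)`, so the kernel `K` has mean `2 ^ (-k)`, and `0 ≤ K ≤
1` bounds its second moment by the same number. The sum of the kernel over the sample is then close
to `a = n * 2 ^ (-k)`, with squared relative error of mean at most `1 / a`. Where the sum is at
least `a / 2`, the denominator may be replaced by `a / 2`; elsewhere trivial bounds are paid for by
that relative error. This gives noise and fluctuation terms of order `2 ^ k / n`.

For the bias, the side of a cell in direction `j` is a product over levels of factors `1 / 2` or
`1`. Averaging over trees factorizes and yields `(1 - 1 / (2 * d)) ^ k`, whose square is at most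
`exp (-k / d)`. At the prescribed depth this and `2 ^ k / n` are both of order `n ^ (-1 / (1 + d *
log 2))` (`kerfEstimate_risk_le`, `risk_terms_le`). -/

/-- The node of level `k` reached by `x` in the tree `c`. -/
def treePath {d : ℕ} (c : SplitTree d) (x : EuclideanSpace ℝ (Fin d)) : ℕ → List Bool
  | 0 => []
  | k + 1 => decide (splitPoint c (treePath c x k) < x (c (treePath c x k))) :: treePath c x k

/-- The directional tree whose first `k` levels are split along the coordinates `θ`. -/
def levelTree {d k : ℕ} [NeZero d] (θ : Fin k → Fin d) : SplitTree d :=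
  -- The value `0` beyond level `k` is arbitrary: cells of depth `k` only see the levels below `k`.
  directionalTree fun l => if h : l < k then θ ⟨l, h⟩ else 0

/-! ### Geometry of cells: paths, volumes and side lengths. -/

section Geometry

variable {d : ℕ}

@[simp] lemma length_treePath (c : SplitTree d) (x : EuclideanSpace ℝ (Fin d)) (k : ℕ) :
    (treePath c x k).length = k := by
  induction k with
  | zero => rfl
  | succ k ih => simp [treePath, ih]

/-- Together with `eq_treePath_of_mem_nodeCell`, this shows that each point of the cube lies in
exactly one cell per level, so the existential in `leafCell` picks out a single node. -/
lemma mem_nodeCell_treePath (c : SplitTree d) {x : EuclideanSpace ℝ (Fin d)}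
    (hx : x ∈ unitCube d) (k : ℕ) : x ∈ nodeCell c (treePath c x k) := by
  induction k with
  | zero => exact hx
  | succ k ih =>
    refine ⟨ih, ?_⟩
    by_cases h : splitPoint c (treePath c x k) < x (c (treePath c x k))
    · simp [h]
    · simp [h, not_lt.1 h]

lemma eq_treePath_of_mem_nodeCell (c : SplitTree d) {x : EuclideanSpace ℝ (Fin d)}
    {v : List Bool} (hv : x ∈ nodeCell c v) : v = treePath c x v.length := by
  induction v with
  | nil => rfl
  | cons b v ih =>
    obtain ⟨h1, h2⟩ := hv
    rw [List.length_cons, treePath, ← ih h1]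
    cases b
    · simpa using h2
    · simpa using h2

lemma leafCell_eq_nodeCell (c : SplitTree d) {x : EuclideanSpace ℝ (Fin d)}
    (hx : x ∈ unitCube d) (k : ℕ) : leafCell c k x = nodeCell c (treePath c x k) := by
  ext z
  constructor
  · rintro ⟨v, rfl, hv, hz⟩
    rwa [← eq_treePath_of_mem_nodeCell c hv]
  · intro hz
    exact ⟨_, length_treePath c x k, mem_nodeCell_treePath c hx k, hz⟩

/-- Agreement is required only along the path in `c'`: inductively the two paths coincide so far,
hence both trees make the next split at the same node, coordinate and midpoint. -/
lemma treePath_congr {c c' : SplitTree d} {x : EuclideanSpace ℝ (Fin d)} {k : ℕ}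
    (h : ∀ l < k, c (treePath c' x l) = c' (treePath c' x l)) :
    treePath c x k = treePath c' x k ∧
      nodeCorners c (treePath c' x k) = nodeCorners c' (treePath c' x k) ∧
      nodeCell c (treePath c' x k) = nodeCell c' (treePath c' x k) := by
  induction k with
  | zero => exact ⟨rfl, rfl, rfl⟩
  | succ k ih =>
    obtain ⟨h1, h2, h3⟩ := ih fun l hl => h l (by omega)
    have hk := h k (by omega)
    have hs : splitPoint c (treePath c' x k) = splitPoint c' (treePath c' x k) := by
      simp only [splitPoint, h2, hk]
    refine ⟨?_, ?_, ?_⟩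
    · simp only [treePath, h1, hs, hk]
    · simp only [treePath, nodeCorners, h2, hk]
    · simp only [treePath, nodeCell, h3, hs, hk]

lemma leafCell_congr {c c' : SplitTree d} {x : EuclideanSpace ℝ (Fin d)} (hx : x ∈ unitCube d)
    {k : ℕ} (h : ∀ l < k, c (treePath c' x l) = c' (treePath c' x l)) :
    leafCell c k x = leafCell c' k x := by
  obtain ⟨h1, -, h3⟩ := treePath_congr h
  rw [leafCell_eq_nodeCell c hx, leafCell_eq_nodeCell c' hx, h1, h3]

lemma nodeCorners_lt (c : SplitTree d) (v : List Bool) (j : Fin d) :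
    (nodeCorners c v).1 j < (nodeCorners c v).2 j := by
  induction v generalizing j with
  | nil => simp [nodeCorners]
  | cons b v ih =>
    have h0 := ih (c v)
    have hj := ih j
    cases b
    · by_cases h : j = c v
      · subst h; simp [nodeCorners]; linarith
      · simp [nodeCorners, h, hj]
    · by_cases h : j = c v
      · subst h; simp [nodeCorners]; linarith
      · simp [nodeCorners, h, hj]

lemma nodeCorners_sub_cons (c : SplitTree d) (b : Bool) (v : List Bool) (j : Fin d) :
    (nodeCorners c (b :: v)).2 j - (nodeCorners c (b :: v)).1 j =
      ((nodeCorners c v).2 j - (nodeCorners c v).1 j) * (if c v = j then 1 / 2 else 1) := by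
  cases b
  · by_cases h : c v = j
    · subst h; simp [nodeCorners]; ring
    · simp [nodeCorners, h, Ne.symm h]
  · by_cases h : c v = j
    · subst h; simp [nodeCorners]; ring
    · simp [nodeCorners, h, Ne.symm h]

lemma nodeCorners_bounds (c : SplitTree d) (v : List Bool) (j : Fin d) :
    0 ≤ (nodeCorners c v).1 j ∧ (nodeCorners c v).2 j ≤ 1 := by
  induction v with
  | nil => simp [nodeCorners]
  | cons b v ih =>
    have hj := nodeCorners_lt c v j
    cases b
    · by_cases h : j = c v
      · subst h; simp [nodeCorners]; exact ⟨ih.1, by linarith [ih.2]⟩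
      · simpa [nodeCorners, h] using ih
    · by_cases h : j = c v
      · subst h; simp [nodeCorners]; exact ⟨by linarith [ih.1], ih.2⟩
      · simpa [nodeCorners, h] using ih

/-- Each split halves exactly one side, whichever coordinate is chosen; hence the volume of a cell
depends on its level alone. -/
lemma prod_nodeCorners_sub (c : SplitTree d) (v : List Bool) :
    ∏ j, ((nodeCorners c v).2 j - (nodeCorners c v).1 j) = (1 / 2) ^ v.length := by
  induction v with
  | nil => simp [nodeCorners]
  | cons b v ih =>
    simp_rw [nodeCorners_sub_cons, Finset.prod_mul_distrib, ih]
    simp [pow_succ]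

lemma nodeCell_subset_Icc (c : SplitTree d) (v : List Bool) {z : EuclideanSpace ℝ (Fin d)}
    (hz : z ∈ nodeCell c v) (j : Fin d) :
    z j ∈ Set.Icc ((nodeCorners c v).1 j) ((nodeCorners c v).2 j) := by
  induction v with
  | nil => exact hz j
  | cons b v ih =>
    obtain ⟨h1, h2⟩ := hz
    have hj := ih h1
    cases b
    · by_cases h : j = c v
      · subst h; simp [splitPoint] at h2; simp [nodeCorners]; exact ⟨hj.1, h2⟩
      · simpa [nodeCorners, h] using hj
    · by_cases h : j = c v
      · subst h; simp [splitPoint] at h2; simp [nodeCorners]; exact ⟨h2.le, hj.2⟩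
      · simpa [nodeCorners, h] using hj

lemma mem_nodeCell_of_mem_Ioc (c : SplitTree d) (v : List Bool) {z : EuclideanSpace ℝ (Fin d)}
    (hz : ∀ j, z j ∈ Set.Ioc ((nodeCorners c v).1 j) ((nodeCorners c v).2 j)) :
    z ∈ nodeCell c v := by
  induction v with
  | nil => exact fun j => ⟨(hz j).1.le, (hz j).2⟩
  | cons b v ih =>
    have h0 := nodeCorners_lt c v (c v)
    have hc := hz (c v)
    refine ⟨ih fun j => ?_, ?_⟩
    · have hj := hz j
      cases b
      · by_cases h : j = c v
        · subst h; simp [nodeCorners] at hj; exact ⟨hj.1, by linarith [hj.2]⟩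
        · simpa [nodeCorners, h] using hj
      · by_cases h : j = c v
        · subst h; simp [nodeCorners] at hj; exact ⟨by linarith [hj.1], hj.2⟩
        · simpa [nodeCorners, h] using hj
    · cases b
      · simp [nodeCorners] at hc; simpa [splitPoint] using hc.2
      · simp [nodeCorners] at hc; simpa [splitPoint] using hc.1

lemma nodeCell_subset_unitCube (c : SplitTree d) (v : List Bool) : nodeCell c v ⊆ unitCube d := by
  intro z hz j
  have h := nodeCell_subset_Icc c v hz j
  have h' := nodeCorners_bounds c v j
  exact ⟨h'.1.trans h.1, h.2.trans h'.2⟩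

lemma measurableSet_unitCube : MeasurableSet (unitCube d) := by
  have : unitCube d = ⋂ j, {x : EuclideanSpace ℝ (Fin d) | 0 ≤ x j ∧ x j ≤ 1} := by
    ext; simp [unitCube]
  rw [this]
  refine MeasurableSet.iInter fun j => ?_
  have hj : Measurable fun x : EuclideanSpace ℝ (Fin d) => x j := by fun_prop
  exact (measurableSet_le measurable_const hj).inter (measurableSet_le hj measurable_const)

lemma measurableSet_nodeCell (c : SplitTree d) (v : List Bool) :
    MeasurableSet (nodeCell c v) := by
  induction v with
  | nil => exact measurableSet_unitCube
  | cons b v ih =>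
    refine ih.inter ?_
    have hv : Measurable fun x : EuclideanSpace ℝ (Fin d) => x (c v) := by fun_prop
    cases b
    · simpa using measurableSet_le hv measurable_const
    · simpa using measurableSet_lt measurable_const hv

/-- The cell lies between the half-open and the closed box with the same corners, which have equal
volume; which faces it contains (lower faces on the boundary of the cube do belong) is thus
irrelevant. -/
lemma volume_nodeCell (c : SplitTree d) (v : List Bool) :
    volume (nodeCell c v) = ENNReal.ofReal ((1 / 2) ^ v.length) := by
  have hmp := EuclideanSpace.volume_preserving_symm_measurableEquiv_toLp (Fin d)
  have hle : ∀ j, 0 ≤ (nodeCorners c v).2 j - (nodeCorners c v).1 j := fun j =>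
    (sub_pos.2 (nodeCorners_lt c v j)).le
  rw [← prod_nodeCorners_sub c v, ENNReal.ofReal_prod_of_nonneg fun j _ => hle j]
  apply le_antisymm
  · calc volume (nodeCell c v)
        ≤ volume ((MeasurableEquiv.toLp 2 (Fin d → ℝ)).symm ⁻¹'
            Set.Icc (nodeCorners c v).1 (nodeCorners c v).2) := by
          refine measure_mono fun z hz => ?_
          exact ⟨fun j => (nodeCell_subset_Icc c v hz j).1,
            fun j => (nodeCell_subset_Icc c v hz j).2⟩
      _ = _ := by
          rw [hmp.measure_preimage measurableSet_Icc.nullMeasurableSet, Real.volume_Icc_pi]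
  · calc _ = volume ((MeasurableEquiv.toLp 2 (Fin d → ℝ)).symm ⁻¹'
            Set.univ.pi fun j => Set.Ioc ((nodeCorners c v).1 j) ((nodeCorners c v).2 j)) := by
          rw [hmp.measure_preimage
            (MeasurableSet.univ_pi fun _ => measurableSet_Ioc).nullMeasurableSet,
            Real.volume_pi_Ioc]
      _ ≤ _ := by
          refine measure_mono fun z hz => ?_
          exact mem_nodeCell_of_mem_Ioc c v fun j => hz j (Set.mem_univ j)

lemma leafCell_subset_unitCube (c : SplitTree d) (k : ℕ) (x : EuclideanSpace ℝ (Fin d)) :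
    leafCell c k x ⊆ unitCube d := by
  rintro z ⟨v, -, -, hz⟩
  exact nodeCell_subset_unitCube c v hz

lemma measurableSet_leafCell (c : SplitTree d) {x : EuclideanSpace ℝ (Fin d)}
    (hx : x ∈ unitCube d) (k : ℕ) : MeasurableSet (leafCell c k x) := by
  rw [leafCell_eq_nodeCell c hx]
  exact measurableSet_nodeCell _ _

lemma volume_leafCell (c : SplitTree d) {x : EuclideanSpace ℝ (Fin d)}
    (hx : x ∈ unitCube d) (k : ℕ) :
    (volume.restrict (unitCube d)).real (leafCell c k x) = (1 / 2) ^ k := by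
  rw [measureReal_restrict_apply (measurableSet_leafCell c hx k),
    Set.inter_eq_left.2 (leafCell_subset_unitCube c k x), leafCell_eq_nodeCell c hx,
    measureReal_def, volume_nodeCell, length_treePath, ENNReal.toReal_ofReal (by positivity)]

lemma nodeCorners_sub_directionalTree (θ : ℕ → Fin d) (v : List Bool) (j : Fin d) :
    (nodeCorners (directionalTree θ) v).2 j - (nodeCorners (directionalTree θ) v).1 j =
      ∏ l ∈ Finset.range v.length, if θ l = j then (1 / 2 : ℝ) else 1 := by
  induction v with
  | nil => simp [nodeCorners]
  | cons b v ih =>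
    rw [nodeCorners_sub_cons, ih, List.length_cons, Finset.prod_range_succ, directionalTree]

/-- The Euclidean norm is bounded by the sum of the coordinate distances. This separates the
directions, and the product over levels is the form that factorizes when averaged over `θ`. -/
lemma norm_sub_le_of_mem_leafCell [NeZero d] {k : ℕ} (θ : Fin k → Fin d)
    {x z : EuclideanSpace ℝ (Fin d)} (hx : x ∈ unitCube d) (hz : z ∈ leafCell (levelTree θ) k x) :
    ‖z - x‖ ≤ ∑ j, ∏ l, if θ l = j then (1 / 2 : ℝ) else 1 := by
  rw [leafCell_eq_nodeCell _ hx] at hz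
  have hx' := mem_nodeCell_treePath (levelTree θ) hx k
  calc ‖z - x‖ ≤ ∑ j, |(z - x) j| := by
        rw [EuclideanSpace.norm_eq]
        refine Real.sqrt_le_iff.2 ⟨Finset.sum_nonneg fun _ _ => abs_nonneg _, ?_⟩
        simpa using Finset.sum_sq_le_sq_sum_of_nonneg (s := Finset.univ)
          (f := fun j => |(z - x) j|) fun _ _ => abs_nonneg _
    _ ≤ _ := by
        refine Finset.sum_le_sum fun j _ => ?_
        have h1 := nodeCell_subset_Icc _ _ hz j
        have h2 := nodeCell_subset_Icc _ _ hx' j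
        have h3 := nodeCorners_sub_directionalTree
          (fun l => if h : l < k then θ ⟨l, h⟩ else 0) (treePath (levelTree θ) x k) j
        rw [length_treePath, Finset.prod_range] at h3
        simp only [Fin.is_lt, dite_true, Fin.eta] at h3
        rw [← h3, PiLp.sub_apply]
        change |z j - x j| ≤ (nodeCorners (levelTree θ) _).2 j - (nodeCorners (levelTree θ) _).1 j
        rw [abs_le]
        constructor <;> linarith [h1.1, h1.2, h2.1, h2.2]

end Geometry

/-- The kernel of the infinite KeRF: the probability that `z` lies in the cell of `x`. -/
def kerfKernel {d : ℕ} [NeZero d] (k : ℕ) (x z : EuclideanSpace ℝ (Fin d)) : ℝ :=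
  ((d : ℝ) ^ k)⁻¹ * ∑ θ : Fin k → Fin d, (leafCell (levelTree θ) k x).indicator (fun _ => 1) z

/-! ### Frequencies of coordinate choices in a random forest. -/

section Frequencies

lemma IsIIDUniformCoords.precomp {Ω : Type*} [MeasurableSpace Ω] {P : Measure Ω} {d : ℕ}
    {ι κ : Type*} {Θ : ι → Ω → Fin d}
    (h : IsIIDUniformCoords P Θ) {g : κ → ι} (hg : g.Injective) : IsIIDUniformCoords P fun a => Θ (g a) :=
  ⟨fun a => h.law (g a), h.indep.precomp hg⟩

variable {Ω : Type*} [MeasurableSpace Ω] {P : Measure Ω} [IsProbabilityMeasure P] {d : ℕ}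

lemma uniformOn_univ_real_singleton (a : Fin d) :
    (uniformOn (Set.univ : Set (Fin d))).real {a} = (d : ℝ)⁻¹ := by
  simp [measureReal_def, uniformOn_univ]

/-- The frequency of the trees with prescribed coordinates `θ` converges almost surely. -/
lemma ae_tendsto_frequency [NeZero d] {k : ℕ} {U : ℕ × Fin k → Ω → Fin d}
    (hU : IsIIDUniformCoords P U) (θ : Fin k → Fin d) :
    ∀ᵐ ω ∂P, Tendsto (fun M : ℕ =>
      (∑ j ∈ Finset.range M, if ∀ l, U (j, l) ω = θ l then (1 : ℝ) else 0) / M) atTop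
        (𝓝 ((d : ℝ) ^ k)⁻¹) := by
  have hlaw : ∀ j, HasLaw (fun ω l => U (j, l) ω)
      (Measure.pi fun _ : Fin k => uniformOn (Set.univ : Set (Fin d))) P := fun j =>
    iIndepFun.hasLaw_pi (fun l => hU.law (j, l)) (hU.indep.precomp (Prod.mk_right_injective j))
  let φ : (Fin k → Fin d) → ℝ := fun u => if ∀ l, u l = θ l then 1 else 0
  have hφ : Measurable φ := Measurable.of_discrete
  have hφ' : φ = ({θ} : Set (Fin k → Fin d)).indicator fun _ => 1 := by
    ext u
    simp only [φ, Set.indicator_apply, Set.mem_singleton_iff, funext_iff]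
  have hmean : P[fun ω => φ fun l => U (0, l) ω] = ((d : ℝ) ^ k)⁻¹ := by
    have := (hlaw 0).integral_comp (f := φ) hφ.aestronglyMeasurable
    simp only [Function.comp_def] at this
    rw [this, hφ', integral_indicator_const _ (measurableSet_singleton _), measureReal_def,
      Measure.pi_singleton, ENNReal.toReal_prod]
    simp [← measureReal_def, uniformOn_univ_real_singleton]
  rw [← hmean]
  -- The frequency is an empirical mean of identically distributed indicators. Pairwise independence
  -- suffices here, and holds because different trees use disjoint blocks of coordinates.
  refine strong_law_ae_real (fun j ω => φ fun l => U (j, l) ω) ?_ ?_ ?_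
  · refine Integrable.of_bound
      (hφ.comp_aemeasurable (hlaw 0).aemeasurable).aestronglyMeasurable 1 (.of_forall fun ω => ?_)
    simp only [φ]
    split_ifs <;> simp
  · intro i j hij
    let S : ℕ → Finset (ℕ × Fin k) := fun j => Finset.univ.image fun l => (j, l)
    have hmem : ∀ j l, (j, l) ∈ S j := by simp [S]
    have hS : Disjoint (S i) (S j) := by
      rw [Finset.disjoint_left]
      rintro ⟨a, l⟩ ha hb
      simp only [S, Finset.mem_image, Finset.mem_univ, true_and, Prod.mk.injEq] at ha hb
      obtain ⟨_, rfl, _⟩ := ha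
      obtain ⟨_, rfl, _⟩ := hb
      exact hij rfl
    have h := hU.indep.indepFun_finset₀ (S i) (S j) hS fun a => (hU.law a).aemeasurable
    exact h.comp (φ := fun u : S i → Fin d => φ fun l => u ⟨(i, l), hmem i l⟩)
      (ψ := fun u : S j → Fin d => φ fun l => u ⟨(j, l), hmem j l⟩)
      Measurable.of_discrete Measurable.of_discrete
  · intro j
    exact IdentDistrib.comp ⟨(hlaw j).aemeasurable, (hlaw 0).aemeasurable,
      (hlaw j).map_eq.trans (hlaw 0).map_eq.symm⟩ hφ

/-- The sequence of trees `T` follows the coordinates `θ` along the nodes `p` with frequency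
`d ^ (-k)`. -/
def HasUniformPaths {d : ℕ} (k : ℕ) (T : ℕ → SplitTree d) : Prop :=
  ∀ (p : Fin k → List Bool), (∀ l, (p l).length = l) → ∀ θ : Fin k → Fin d,
    Tendsto (fun M : ℕ =>
      (∑ j ∈ Finset.range M, if ∀ l, T j (p l) = θ l then (1 : ℝ) else 0) / M) atTop
        (𝓝 ((d : ℝ) ^ k)⁻¹)

lemma ae_hasUniformPaths_directional [NeZero d] {Θ : ℕ → ℕ → Ω → Fin d}
    (hΘ : IsIIDUniformCoords P (fun q : ℕ × ℕ => Θ q.1 q.2)) (k : ℕ) :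
    ∀ᵐ ω ∂P, HasUniformPaths k fun j => directionalTree fun l => Θ j l ω := by
  have hg : Function.Injective fun a : ℕ × Fin k => (a.1, (a.2 : ℕ)) := by
    rintro ⟨a, l⟩ ⟨b, l'⟩ h
    simpa [Fin.ext_iff] using h
  have h := fun θ : Fin k → Fin d => ae_tendsto_frequency (hΘ.precomp hg) θ
  filter_upwards [ae_all_iff.2 h] with ω hω p hp θ
  simpa [directionalTree, hp] using hω θ

lemma ae_hasUniformPaths_centered [NeZero d] {Ψ : ℕ → List Bool → Ω → Fin d}
    (hΨ : IsIIDUniformCoords P (fun q : ℕ × List Bool => Ψ q.1 q.2)) (k : ℕ) :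
    ∀ᵐ ω ∂P, HasUniformPaths k fun j v => Ψ j v ω := by
  have h : ∀ p : Fin k → List Bool, ∀ᵐ ω ∂P, (∀ l, (p l).length = l) → ∀ θ : Fin k → Fin d,
      Tendsto (fun M : ℕ =>
        (∑ j ∈ Finset.range M, if ∀ l, Ψ j (p l) ω = θ l then (1 : ℝ) else 0) / M) atTop
          (𝓝 ((d : ℝ) ^ k)⁻¹) := by
    intro p
    by_cases hp : ∀ l, (p l).length = l
    -- Nodes of different lengths are different, so the choices made along `p` are distinct members
    -- of the independent family `Ψ`.
    · have hg : Function.Injective fun a : ℕ × Fin k => (a.1, p a.2) := by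
        rintro ⟨a, l⟩ ⟨b, l'⟩ h
        simp only [Prod.mk.injEq] at h
        have := congrArg List.length h.2
        rw [hp, hp] at this
        exact Prod.ext h.1 (Fin.ext this)
      have h := fun θ : Fin k → Fin d => ae_tendsto_frequency (hΨ.precomp hg) θ
      filter_upwards [ae_all_iff.2 h] with ω hω _ θ using hω θ
    · exact .of_forall fun ω h => absurd h hp
  -- There are countably many `p`, so the exceptional null sets can be united.
  exact ae_all_iff.2 h

end Frequencies

/-! ### The infinite KeRF as a kernel estimator. -/

section Limit

variable {d : ℕ} [NeZero d]

/-- A tree puts `z` in the cell of `x` according to the coordinates that it chooses along the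
path of `x`. -/
lemma indicator_leafCell_eq_sum (T : SplitTree d) {x : EuclideanSpace ℝ (Fin d)}
    (hx : x ∈ unitCube d) (k : ℕ) (z : EuclideanSpace ℝ (Fin d)) :
    (leafCell T k x).indicator (fun _ => (1 : ℝ)) z =
      ∑ θ : Fin k → Fin d, (leafCell (levelTree θ) k x).indicator (fun _ => 1) z *
        if ∀ l : Fin k, T (treePath (levelTree θ) x l) = θ l then 1 else 0 := by
  have hlevel : ∀ (θ : Fin k → Fin d) (l : Fin k),
      levelTree θ (treePath (levelTree θ) x l) = θ l := by
    intro θ l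
    simp [levelTree, directionalTree]
  -- Only `θ₀`, the sequence of coordinates that `T` really uses along the path of `x`, contributes
  -- to the sum; for it the directional tree has the same cell of `x`.
  let θ₀ : Fin k → Fin d := fun l => T (treePath T x l)
  have hagree : ∀ l < k, levelTree θ₀ (treePath T x l) = T (treePath T x l) := by
    intro l hl
    simp [levelTree, directionalTree, hl, θ₀]
  rw [Finset.sum_eq_single θ₀]
  · rw [leafCell_congr hx hagree, if_pos, mul_one]
    intro l
    rw [(treePath_congr fun a ha => hagree a (ha.trans l.2)).1]
  · intro θ _ hθ
    rw [if_neg, mul_zero]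
    intro h
    apply hθ
    ext1 l
    have hT : ∀ a < k, T (treePath (levelTree θ) x a) =
        levelTree θ (treePath (levelTree θ) x a) := fun a ha =>
      (h ⟨a, ha⟩).trans (hlevel θ ⟨a, ha⟩).symm
    simp only [θ₀]
    rw [(treePath_congr fun a ha => hT a (ha.trans l.2)).1, h l]
  · simp

lemma kerfKernel_nonneg (k : ℕ) (x z : EuclideanSpace ℝ (Fin d)) : 0 ≤ kerfKernel k x z :=
  mul_nonneg (by positivity) (Finset.sum_nonneg fun _ _ =>
    Set.indicator_nonneg (fun _ _ => zero_le_one) _)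

lemma kerfKernel_le_one (k : ℕ) (x z : EuclideanSpace ℝ (Fin d)) : kerfKernel k x z ≤ 1 := by
  have hd : (0 : ℝ) < d := by exact_mod_cast Nat.pos_of_neZero d
  have h : ∑ θ : Fin k → Fin d, (leafCell (levelTree θ) k x).indicator (fun _ => (1 : ℝ)) z ≤
      ∑ _θ : Fin k → Fin d, (1 : ℝ) :=
    Finset.sum_le_sum fun θ _ => Set.indicator_le_self' (fun _ _ => zero_le_one) _
  simp only [Finset.sum_const, Finset.card_univ, Fintype.card_pi, Fintype.card_fin,
    Finset.prod_const, nsmul_eq_mul, mul_one, Nat.cast_pow] at h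
  rw [kerfKernel, inv_mul_le_iff₀ (by positivity), mul_one]
  exact h

lemma HasUniformPaths.tendsto_leafCell {k : ℕ} {T : ℕ → SplitTree d} (hT : HasUniformPaths k T)
    {x : EuclideanSpace ℝ (Fin d)} (hx : x ∈ unitCube d) (z : EuclideanSpace ℝ (Fin d)) :
    Tendsto (fun M : ℕ =>
      (∑ j ∈ Finset.range M, (leafCell (T j) k x).indicator (fun _ => (1 : ℝ)) z) / M) atTop
        (𝓝 (kerfKernel k x z)) := by
  have h : Tendsto (fun M : ℕ => ∑ θ : Fin k → Fin d,
      (leafCell (levelTree θ) k x).indicator (fun _ => (1 : ℝ)) z *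
        ((∑ j ∈ Finset.range M,
          if ∀ l : Fin k, T j (treePath (levelTree θ) x l) = θ l then (1 : ℝ) else 0) / M)) atTop
      (𝓝 (∑ θ : Fin k → Fin d, (leafCell (levelTree θ) k x).indicator (fun _ => (1 : ℝ)) z *
        ((d : ℝ) ^ k)⁻¹)) :=
    tendsto_finsetSum _ fun θ _ => (hT (fun l => treePath (levelTree θ) x l)
      (fun l => length_treePath _ _ _) θ).const_mul _
  rw [← Finset.sum_mul, mul_comm] at h
  refine h.congr fun M => ?_
  simp_rw [fun j => indicator_leafCell_eq_sum (T j) hx k z]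
  rw [Finset.sum_comm, Finset.sum_div]
  simp_rw [← Finset.mul_sum, mul_div_assoc]

/-- Every tree acts on `x` like some directional tree; if none of those joins `z` to `x`, no tree
does. This settles the case of a vanishing limit denominator. -/
lemma indicator_leafCell_eq_zero (T : SplitTree d) {x : EuclideanSpace ℝ (Fin d)}
    (hx : x ∈ unitCube d) {k : ℕ} {z : EuclideanSpace ℝ (Fin d)} (h : kerfKernel k x z = 0) :
    (leafCell T k x).indicator (fun _ => (1 : ℝ)) z = 0 := by
  have hd : (d : ℝ) ≠ 0 := by exact_mod_cast NeZero.ne d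
  rw [kerfKernel, mul_eq_zero, or_iff_right (by positivity),
    Finset.sum_eq_zero_iff_of_nonneg fun _ _ => Set.indicator_nonneg (fun _ _ => zero_le_one) _]
    at h
  rw [indicator_leafCell_eq_sum T hx]
  exact Finset.sum_eq_zero fun θ hθ => by rw [h θ hθ, zero_mul]

lemma HasUniformPaths.tendsto_finiteKeRF {k n : ℕ} {T : ℕ → SplitTree d}
    (hT : HasUniformPaths k T) (X : Fin n → EuclideanSpace ℝ (Fin d)) (Y : Fin n → ℝ)
    {x : EuclideanSpace ℝ (Fin d)} (hx : x ∈ unitCube d) :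
    Tendsto (fun M : ℕ => finiteKeRF M T k X Y x) atTop
      (𝓝 ((∑ i, Y i * kerfKernel k x (X i)) / ∑ i, kerfKernel k x (X i))) := by
  by_cases h0 : ∑ i, kerfKernel k x (X i) = 0
  -- If the kernel vanishes at all sample points, every finite estimator has numerator `0` and
  -- equals `0`, in accordance with `0 / 0 = 0` in the limit.
  · rw [h0, div_zero]
    refine tendsto_const_nhds.congr fun M => ?_
    rw [Finset.sum_eq_zero_iff_of_nonneg fun _ _ => kerfKernel_nonneg _ _ _] at h0
    rw [finiteKeRF, Finset.sum_eq_zero fun j _ => Finset.sum_eq_zero fun i hi => by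
      rw [indicator_leafCell_eq_zero (T j) hx (h0 i hi), mul_zero], zero_div]
  · have hnum : Tendsto (fun M : ℕ => ∑ i, Y i *
        ((∑ j ∈ Finset.range M, (leafCell (T j) k x).indicator (fun _ => (1 : ℝ)) (X i)) / M))
        atTop (𝓝 (∑ i, Y i * kerfKernel k x (X i))) :=
      tendsto_finsetSum _ fun i _ => (hT.tendsto_leafCell hx (X i)).const_mul _
    have hden : Tendsto (fun M : ℕ => ∑ i,
        (∑ j ∈ Finset.range M, (leafCell (T j) k x).indicator (fun _ => (1 : ℝ)) (X i)) / M)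
        atTop (𝓝 (∑ i, kerfKernel k x (X i))) :=
      tendsto_finsetSum _ fun i _ => hT.tendsto_leafCell hx (X i)
    refine (hnum.div hden h0).congr' ?_
    filter_upwards [eventually_gt_atTop 0] with M hM
    have hM' : (M : ℝ) ≠ 0 := by exact_mod_cast hM.ne'
    simp only [Pi.div_apply, finiteKeRF, leafCount]
    rw [Finset.sum_comm, Finset.sum_comm (s := Finset.range M), ← Finset.sum_div]
    simp_rw [← Finset.mul_sum, ← mul_div_assoc]
    rw [← Finset.sum_div, div_div_div_cancel_right₀ hM']

lemma HasUniformPaths.infiniteKeRF_eq {k n : ℕ} {T : ℕ → SplitTree d}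
    (hT : HasUniformPaths k T) (X : Fin n → EuclideanSpace ℝ (Fin d)) (Y : Fin n → ℝ)
    {x : EuclideanSpace ℝ (Fin d)} (hx : x ∈ unitCube d) :
    infiniteKeRF T k X Y x =
      (∑ i, Y i * kerfKernel k x (X i)) / ∑ i, kerfKernel k x (X i) :=
  (hT.tendsto_finiteKeRF X Y hx).limUnder_eq

end Limit

/-! ### Moments of sums over an i.i.d. sample. -/

section SampleMoments

variable {E : Type*} [MeasurableSpace E] {ν : Measure E} [IsProbabilityMeasure ν] {n : ℕ}
  {f : E → ℝ}

lemma integral_sum_comp_eval (hf : Integrable f ν) :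
    ∫ X, ∑ i, f (X i) ∂(Measure.pi fun _ : Fin n => ν) = n * ∫ z, f z ∂ν := by
  rw [integral_finsetSum _ fun i _ => integrable_comp_eval (μ := fun _ => ν) hf]
  simp [integral_comp_eval (μ := fun _ : Fin n => ν) hf.aestronglyMeasurable]

lemma variance_sum_comp_eval_le (hf : MemLp f 2 ν) :
    Var[fun X => ∑ i, f (X i); Measure.pi fun _ : Fin n => ν] ≤ n * ∫ z, f z ^ 2 ∂ν := by
  have h := variance_sum_pi (μ := fun _ : Fin n => ν) (X := fun _ => f) fun _ => hf
  have h' : (fun X : Fin n → E => ∑ i, f (X i)) = ∑ i, fun X : Fin n → E => f (X i) := by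
    ext X; simp
  rw [h', h, Finset.sum_const, Finset.card_univ, Fintype.card_fin, nsmul_eq_mul]
  gcongr
  exact variance_le_expectation_sq hf.aestronglyMeasurable

lemma memLp_sum_comp_eval (hf : MemLp f 2 ν) :
    MemLp (fun X => ∑ i, f (X i)) 2 (Measure.pi fun _ : Fin n => ν) :=
  memLp_finsetSum _ fun i _ =>
    hf.comp_measurePreserving (measurePreserving_eval (fun _ : Fin n => ν) i)

lemma integral_sum_comp_eval_sub_sq_le (hf : MemLp f 2 ν) :
    ∫ X, (∑ i, f (X i) - n * ∫ z, f z ∂ν) ^ 2 ∂(Measure.pi fun _ : Fin n => ν) ≤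
      n * ∫ z, f z ^ 2 ∂ν := by
  have h := variance_sum_comp_eval_le (n := n) hf
  rwa [variance_eq_integral (memLp_sum_comp_eval hf).aestronglyMeasurable.aemeasurable,
    integral_sum_comp_eval (hf.integrable (by norm_num))] at h

lemma integral_sum_comp_eval_sq_le (hf : MemLp f 2 ν) :
    ∫ X, (∑ i, f (X i)) ^ 2 ∂(Measure.pi fun _ : Fin n => ν) ≤
      n * ∫ z, f z ^ 2 ∂ν + (n * ∫ z, f z ∂ν) ^ 2 := by
  have h := variance_sum_comp_eval_le (n := n) hf
  rw [variance_eq_sub (memLp_sum_comp_eval hf),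
    integral_sum_comp_eval (hf.integrable (by norm_num))] at h
  simp only [Pi.pow_apply] at h
  linarith

end SampleMoments

lemma memLp_id_gaussianReal_two (σ : NNReal) :
    MemLp (fun e : ℝ => e) 2 (gaussianReal 0 (σ ^ 2)) :=
  memLp_id_gaussianReal (μ := 0) (v := σ ^ 2) 2

/-- The second moment of a linear combination of independent Gaussian variables. -/
lemma integral_sum_mul_gaussian_sq {n : ℕ} (σ : NNReal) (w : Fin n → ℝ) :
    ∫ e, (∑ i, w i * e i) ^ 2 ∂(Measure.pi fun _ : Fin n => gaussianReal 0 (σ ^ 2)) =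
      σ ^ 2 * ∑ i, w i ^ 2 := by
  have hm : ∀ i, MemLp (fun e : ℝ => w i * e) 2 (gaussianReal 0 (σ ^ 2)) := fun i =>
    (memLp_id_gaussianReal_two σ).const_mul (w i)
  have h := variance_sum_pi (μ := fun _ : Fin n => gaussianReal 0 (σ ^ 2))
    (X := fun i e => w i * e) hm
  have h' : (∑ i, fun e : Fin n → ℝ => w i * e i) = fun e : Fin n → ℝ => ∑ i, w i * e i := by
    ext e; simp
  have h0 : ∫ e, ∑ i, w i * e i ∂(Measure.pi fun _ : Fin n => gaussianReal 0 (σ ^ 2)) = 0 := by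
    rw [integral_finsetSum _ fun i _ => integrable_comp_eval
      (μ := fun _ : Fin n => gaussianReal 0 (σ ^ 2)) ((hm i).integrable (by norm_num))]
    refine Finset.sum_eq_zero fun i _ => ?_
    rw [integral_comp_eval (μ := fun _ : Fin n => gaussianReal 0 (σ ^ 2))
      (f := fun e : ℝ => w i * e) (hm i).aestronglyMeasurable, integral_const_mul,
      integral_id_gaussianReal, mul_zero]
  rw [h', variance_of_integral_eq_zero (by fun_prop : Measurable _).aemeasurable h0] at h
  rw [h, Finset.mul_sum]
  refine Finset.sum_congr rfl fun i _ => ?_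
  rw [variance_const_mul, variance_fun_id_gaussianReal]
  push_cast
  ring

/-! ### Deterministic bounds for normalized weights. -/

section Weights

variable {n : ℕ} {K : Fin n → ℝ} {a : ℝ}

/-- The weights are nonnegative and sum to `1`, or to `0` when the denominator vanishes. -/
lemma sum_sq_weights_le_one (hK : ∀ i, 0 ≤ K i) : ∑ i, (K i / ∑ j, K j) ^ 2 ≤ 1 := by
  have hS : 0 ≤ ∑ j, K j := Finset.sum_nonneg fun i _ => hK i
  calc _ ≤ (∑ i, K i / ∑ j, K j) ^ 2 :=
        Finset.sum_sq_le_sq_sum_of_nonneg fun i _ => div_nonneg (hK i) hS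
    _ ≤ 1 := by
        rw [← Finset.sum_div]
        exact pow_le_one₀ (div_nonneg hS hS) (div_self_le_one _)

/-- Pointwise form of Chebyshev's inequality: the indicator of the bad event `S < a / 2` is
dominated by a multiple of the squared deviation, so no probability has to be estimated separately.
-/
lemma one_le_of_sum_lt_half (ha : 0 < a) {S : ℝ} (hS : S < a / 2) :
    1 ≤ 4 * (S - a) ^ 2 / a ^ 2 := by
  rw [le_div_iff₀ (by positivity)]
  nlinarith

lemma sum_sq_weights_le (hK : ∀ i, 0 ≤ K i) (ha : 0 < a) :
    ∑ i, (K i / ∑ j, K j) ^ 2 ≤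
      4 * (∑ i, K i ^ 2) / a ^ 2 + 4 * (∑ i, K i - a) ^ 2 / a ^ 2 := by
  rcases lt_or_ge (∑ i, K i) (a / 2) with h | h
  · have h1 := one_le_of_sum_lt_half ha h
    have h2 := sum_sq_weights_le_one hK
    have h3 : 0 ≤ 4 * (∑ i, K i ^ 2) / a ^ 2 := by positivity
    linarith
  · have h3 : 0 ≤ 4 * (∑ i, K i - a) ^ 2 / a ^ 2 := by positivity
    have h4 : ∑ i, (K i / ∑ j, K j) ^ 2 ≤ 4 * (∑ i, K i ^ 2) / a ^ 2 := by
      have hpos : 0 < ∑ i, K i := by linarith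
      simp_rw [div_pow]
      rw [← Finset.sum_div, mul_comm, mul_div_assoc, div_eq_mul_inv]
      gcongr
      rw [← one_div, div_le_div_iff₀ (by positivity) (by positivity)]
      nlinarith
    linarith

/-- If the denominator is at least `a / 2`, the Lipschitz bound is used; otherwise the error is at
most `2 * B`, also when the denominator is `0` and the estimate is `0`. The factor `K i` in `hB` and
`hL` restricts these conditions to points with nonzero kernel, which lie in the cube. -/
lemma bias_sq_le (hK : ∀ i, 0 ≤ K i) (ha : 0 < a) {m D : Fin n → ℝ} {m₀ L B : ℝ}
    (hm₀ : |m₀| ≤ B) (hB : ∀ i, K i * |m i - m₀| ≤ 2 * B * K i)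
    (hL : ∀ i, K i * |m i - m₀| ≤ L * (K i * D i)) :
    ((∑ i, m i * K i) / (∑ i, K i) - m₀) ^ 2 ≤
      4 * L ^ 2 * (∑ i, K i * D i) ^ 2 / a ^ 2 +
        4 * B ^ 2 * (4 * (∑ i, K i - a) ^ 2 / a ^ 2) := by
  have hB0 : 0 ≤ B := (abs_nonneg _).trans hm₀
  have hS : 0 ≤ ∑ i, K i := Finset.sum_nonneg fun i _ => hK i
  have hsum : (∑ i, K i) ≠ 0 → (∑ i, m i * K i) / (∑ i, K i) - m₀ =
      (∑ i, K i * (m i - m₀)) / ∑ i, K i := by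
    intro h
    rw [eq_div_iff h, sub_mul, div_mul_cancel₀ _ h, Finset.mul_sum, ← Finset.sum_sub_distrib]
    exact Finset.sum_congr rfl fun i _ => by ring
  have habs : |∑ i, K i * (m i - m₀)| ≤ ∑ i, K i * |m i - m₀| :=
    (Finset.abs_sum_le_sum_abs _ _).trans_eq <| Finset.sum_congr rfl fun i _ => by
      rw [abs_mul, abs_of_nonneg (hK i)]
  rcases lt_or_ge (∑ i, K i) (a / 2) with h | h
  · have h1 := one_le_of_sum_lt_half ha h
    have h3 : 0 ≤ 4 * L ^ 2 * (∑ i, K i * D i) ^ 2 / a ^ 2 := by positivity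
    have h4 : |(∑ i, m i * K i) / (∑ i, K i) - m₀| ≤ 2 * B := by
      by_cases h0 : ∑ i, K i = 0
      · rw [h0, div_zero, zero_sub, abs_neg]; linarith
      · rw [hsum h0, abs_div, abs_of_nonneg hS, div_le_iff₀ (lt_of_le_of_ne hS (Ne.symm h0)),
          Finset.mul_sum]
        exact habs.trans (Finset.sum_le_sum fun i _ => hB i)
    have h5 : ((∑ i, m i * K i) / (∑ i, K i) - m₀) ^ 2 ≤ 4 * B ^ 2 := by
      rw [← sq_abs]
      calc _ ≤ (2 * B) ^ 2 := pow_le_pow_left₀ (abs_nonneg _) h4 2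
        _ = _ := by ring
    nlinarith [sq_nonneg B]
  · have h3 : 0 ≤ 4 * B ^ 2 * (4 * (∑ i, K i - a) ^ 2 / a ^ 2) := by positivity
    have hpos : 0 < ∑ i, K i := by linarith
    have h4 : |∑ i, K i * (m i - m₀)| ≤ L * ∑ i, K i * D i := by
      rw [Finset.mul_sum]
      exact habs.trans (Finset.sum_le_sum fun i _ => hL i)
    have h5 : ((∑ i, m i * K i) / (∑ i, K i) - m₀) ^ 2 ≤
        4 * L ^ 2 * (∑ i, K i * D i) ^ 2 / a ^ 2 := by
      rw [hsum hpos.ne', div_pow, ← sq_abs, div_le_div_iff₀ (by positivity) (by positivity)]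
      calc _ ≤ (L * ∑ i, K i * D i) ^ 2 * (2 * ∑ i, K i) ^ 2 := by
            gcongr
            linarith
        _ = _ := by ring
    linarith

end Weights

/-! ### Moments of the kernel. -/

section KernelMoments

/-- For a fixed direction, the sum over `θ` of a product over levels is the `k`-th power of the
one-level sum `(d - 1) + 1 / 2`. -/
lemma sum_side_lengths (d k : ℕ) :
    ∑ θ : Fin k → Fin d, ∑ j, ∏ l, (if θ l = j then (1 / 2 : ℝ) else 1) =
      d * ((d : ℝ) - 1 / 2) ^ k := by
  have h : ∀ j : Fin d, ∑ θ : Fin k → Fin d, ∏ l, (if θ l = j then (1 / 2 : ℝ) else 1) =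
      ((d : ℝ) - 1 / 2) ^ k := by
    intro j
    have h1 : ∑ i : Fin d, (if i = j then (1 / 2 : ℝ) else 1) = (d : ℝ) - 1 / 2 := by
      have : ∀ i : Fin d, (if i = j then (1 / 2 : ℝ) else 1) = 1 - if i = j then 1 / 2 else 0 := by
        intro i; split_ifs <;> norm_num
      simp_rw [this, Finset.sum_sub_distrib]
      simp
    rw [← h1, Finset.sum_pow', Fintype.piFinset_univ]
  rw [Finset.sum_comm, Finset.sum_congr rfl fun j _ => h j]
  simp

variable {d : ℕ} [NeZero d]

instance isProbabilityMeasure_unitCube : IsProbabilityMeasure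
    ((volume : Measure (EuclideanSpace ℝ (Fin d))).restrict (unitCube d)) where
  measure_univ := by
    rw [Measure.restrict_apply_univ]
    simpa [nodeCell] using volume_nodeCell (fun _ => (0 : Fin d)) []

lemma measurable_kerfKernel {x : EuclideanSpace ℝ (Fin d)} (hx : x ∈ unitCube d) (k : ℕ) :
    Measurable (kerfKernel k x) :=
  (Finset.measurable_fun_sum _ fun θ _ =>
    measurable_const.indicator (measurableSet_leafCell (levelTree θ) hx k)).const_mul _

lemma mem_unitCube_of_kerfKernel_ne_zero {k : ℕ} {x z : EuclideanSpace ℝ (Fin d)}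
    (h : kerfKernel k x z ≠ 0) : z ∈ unitCube d := by
  contrapose! h
  rw [kerfKernel, Finset.sum_eq_zero fun θ _ => Set.indicator_of_notMem
    (fun hz => h (leafCell_subset_unitCube _ _ _ hz)) _, mul_zero]

lemma integral_kerfKernel {x : EuclideanSpace ℝ (Fin d)} (hx : x ∈ unitCube d) (k : ℕ) :
    ∫ z, kerfKernel k x z ∂(volume.restrict (unitCube d)) = (1 / 2) ^ k := by
  have hd : (d : ℝ) ≠ 0 := by exact_mod_cast NeZero.ne d
  simp only [kerfKernel]
  rw [integral_const_mul, integral_finsetSum _ fun θ _ =>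
    (integrable_const (1 : ℝ)).indicator (measurableSet_leafCell (levelTree θ) hx k)]
  simp only [integral_indicator_const _ (measurableSet_leafCell (levelTree _) hx k),
    volume_leafCell _ hx k]
  simp only [smul_eq_mul, mul_one, Finset.sum_const, Finset.card_univ, Fintype.card_pi,
    Fintype.card_fin, Finset.prod_const, nsmul_eq_mul, Nat.cast_pow]
  rw [inv_mul_cancel_left₀ (by positivity)]

lemma kerfKernel_mul_norm_le {x : EuclideanSpace ℝ (Fin d)} (hx : x ∈ unitCube d) (k : ℕ)
    (z : EuclideanSpace ℝ (Fin d)) :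
    kerfKernel k x z * ‖z - x‖ ≤ ((d : ℝ) ^ k)⁻¹ * ∑ θ : Fin k → Fin d,
      (∑ j, ∏ l, if θ l = j then (1 / 2 : ℝ) else 1) *
        (leafCell (levelTree θ) k x).indicator (fun _ => 1) z := by
  rw [kerfKernel, mul_assoc, Finset.sum_mul]
  refine mul_le_mul_of_nonneg_left (Finset.sum_le_sum fun θ _ => ?_) (by positivity)
  by_cases hz : z ∈ leafCell (levelTree θ) k x
  · rw [Set.indicator_of_mem hz, one_mul, mul_one]
    exact norm_sub_le_of_mem_leafCell θ hx hz
  · rw [Set.indicator_of_notMem hz, zero_mul, mul_zero]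

/-- The cube is the cell of depth `0`, with `d` sides of length `1`. -/
lemma norm_sub_le_of_mem_unitCube {x z : EuclideanSpace ℝ (Fin d)} (hx : x ∈ unitCube d)
    (hz : z ∈ unitCube d) : ‖z - x‖ ≤ d := by
  have h := norm_sub_le_of_mem_leafCell (k := 0) (fun _ => (0 : Fin d)) hx (z := z)
    ⟨[], rfl, hx, hz⟩
  simpa using h

lemma kerfKernel_mul_norm_le_mul {x : EuclideanSpace ℝ (Fin d)} (hx : x ∈ unitCube d) (k : ℕ)
    (z : EuclideanSpace ℝ (Fin d)) :
    kerfKernel k x z * ‖z - x‖ ≤ kerfKernel k x z * d := by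
  by_cases h : kerfKernel k x z = 0
  · simp [h]
  · exact mul_le_mul_of_nonneg_left
      (norm_sub_le_of_mem_unitCube hx (mem_unitCube_of_kerfKernel_ne_zero h))
      (kerfKernel_nonneg _ _ _)

lemma memLp_kerfKernel {x : EuclideanSpace ℝ (Fin d)} (hx : x ∈ unitCube d) (k : ℕ)
    (p : ENNReal) : MemLp (kerfKernel k x) p (volume.restrict (unitCube d)) :=
  MemLp.of_bound (measurable_kerfKernel hx k).aestronglyMeasurable 1 <| .of_forall fun z => by
    rw [Real.norm_of_nonneg (kerfKernel_nonneg _ _ _)]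
    exact kerfKernel_le_one _ _ _

lemma memLp_kerfKernel_mul_norm {x : EuclideanSpace ℝ (Fin d)} (hx : x ∈ unitCube d) (k : ℕ)
    (p : ENNReal) :
    MemLp (fun z => kerfKernel k x z * ‖z - x‖) p (volume.restrict (unitCube d)) := by
  have hm := measurable_kerfKernel hx k
  refine MemLp.of_bound (by fun_prop : Measurable _).aestronglyMeasurable d <|
    .of_forall fun z => ?_
  rw [Real.norm_of_nonneg (mul_nonneg (kerfKernel_nonneg _ _ _) (norm_nonneg _))]
  exact (kerfKernel_mul_norm_le_mul hx k z).trans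
    (mul_le_of_le_one_left (Nat.cast_nonneg d) (kerfKernel_le_one k x z))

/-- Only `K ^ 2 ≤ K` is used; this already gives a variance of order `2 ^ k / n`. -/
lemma integral_kerfKernel_sq_le {x : EuclideanSpace ℝ (Fin d)} (hx : x ∈ unitCube d) (k : ℕ) :
    ∫ z, kerfKernel k x z ^ 2 ∂(volume.restrict (unitCube d)) ≤ (1 / 2) ^ k := by
  rw [← integral_kerfKernel hx k]
  refine integral_mono (memLp_kerfKernel hx k 2).integrable_sq
    ((memLp_kerfKernel hx k 1).integrable le_rfl) fun z => ?_
  exact pow_le_of_le_one (kerfKernel_nonneg _ _ _) (kerfKernel_le_one _ _ _) two_ne_zero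

lemma integral_kerfKernel_mul_norm_sq_le {x : EuclideanSpace ℝ (Fin d)} (hx : x ∈ unitCube d)
    (k : ℕ) :
    ∫ z, (kerfKernel k x z * ‖z - x‖) ^ 2 ∂(volume.restrict (unitCube d)) ≤
      d ^ 2 * (1 / 2) ^ k := by
  have h : ∫ z, (kerfKernel k x z * ‖z - x‖) ^ 2 ∂(volume.restrict (unitCube d)) ≤
      ∫ z, (d : ℝ) ^ 2 * kerfKernel k x z ^ 2 ∂(volume.restrict (unitCube d)) := by
    refine integral_mono (memLp_kerfKernel_mul_norm hx k 2).integrable_sq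
      ((memLp_kerfKernel hx k 2).integrable_sq.const_mul _) fun z => ?_
    calc (kerfKernel k x z * ‖z - x‖) ^ 2 ≤ (kerfKernel k x z * d) ^ 2 :=
          pow_le_pow_left₀ (mul_nonneg (kerfKernel_nonneg _ _ _) (norm_nonneg _))
            (kerfKernel_mul_norm_le_mul hx k z) 2
      _ = _ := by ring
  rw [integral_const_mul] at h
  exact h.trans (mul_le_mul_of_nonneg_left (integral_kerfKernel_sq_le hx k) (by positivity))

/-- All cells have the same volume, which factors out and leaves the average of the summed side
lengths over directional trees. -/
lemma integral_kerfKernel_mul_norm_le {x : EuclideanSpace ℝ (Fin d)} (hx : x ∈ unitCube d)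
    (k : ℕ) :
    ∫ z, kerfKernel k x z * ‖z - x‖ ∂(volume.restrict (unitCube d)) ≤
      (1 / 2) ^ k * (d * (1 - 1 / (2 * d)) ^ k) := by
  have hd : (d : ℝ) ≠ 0 := by exact_mod_cast NeZero.ne d
  have hint : ∀ θ : Fin k → Fin d, Integrable (fun z =>
      (∑ j, ∏ l, if θ l = j then (1 / 2 : ℝ) else 1) *
        (leafCell (levelTree θ) k x).indicator (fun _ => (1 : ℝ)) z)
      (volume.restrict (unitCube d)) := fun θ =>
    ((integrable_const (1 : ℝ)).indicator (measurableSet_leafCell (levelTree θ) hx k)).const_mul _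
  refine (integral_mono ((memLp_kerfKernel_mul_norm hx k 1).integrable le_rfl)
    ((integrable_finsetSum _ fun θ _ => hint θ).const_mul _)
    (kerfKernel_mul_norm_le hx k)).trans_eq ?_
  rw [integral_const_mul, integral_finsetSum _ fun θ _ => hint θ]
  simp only [integral_const_mul,
    integral_indicator_const _ (measurableSet_leafCell (levelTree _) hx k), volume_leafCell _ hx k]
  simp only [smul_eq_mul, mul_one]
  rw [← Finset.sum_mul, sum_side_lengths,
    show (1 - 1 / (2 * d) : ℝ) = (d : ℝ)⁻¹ * (d - 1 / 2) by field_simp, mul_pow, inv_pow]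
  ring

end KernelMoments

/-! ### Bias and noise of the kernel estimator. -/

section Risk

variable {d : ℕ} [NeZero d] {n k : ℕ}

/-- The infinite KeRF estimator at `x` for the regression function `g` and the noise `e`. -/
def kerfEstimate (g : EuclideanSpace ℝ (Fin d) → ℝ) (k : ℕ) (x : EuclideanSpace ℝ (Fin d))
    (q : (Fin n → EuclideanSpace ℝ (Fin d)) × (Fin n → ℝ)) : ℝ :=
  (∑ i, (g (q.1 i) + q.2 i) * kerfKernel k x (q.1 i)) / ∑ i, kerfKernel k x (q.1 i)

/-- The weight of the `i`-th observation in the infinite KeRF estimator. -/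
def kerfWeight (k : ℕ) (x : EuclideanSpace ℝ (Fin d)) (X : Fin n → EuclideanSpace ℝ (Fin d))
    (i : Fin n) : ℝ :=
  kerfKernel k x (X i) / ∑ j, kerfKernel k x (X j)

/-- A bound for the conditional squared bias of the KeRF estimator at the sample points `X`. -/
def biasBound (L B : ℝ) (k : ℕ) (x : EuclideanSpace ℝ (Fin d))
    (X : Fin n → EuclideanSpace ℝ (Fin d)) : ℝ :=
  4 * L ^ 2 * (∑ i, kerfKernel k x (X i) * ‖X i - x‖) ^ 2 / (n * (1 / 2) ^ k) ^ 2 +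
    4 * B ^ 2 * (4 * (∑ i, kerfKernel k x (X i) - n * (1 / 2) ^ k) ^ 2 / (n * (1 / 2) ^ k) ^ 2)

lemma kerfEstimate_sub_sq_le {g : EuclideanSpace ℝ (Fin d) → ℝ} {L B : ℝ}
    {x : EuclideanSpace ℝ (Fin d)} (hx : x ∈ unitCube d)
    (hL : ∀ z ∈ unitCube d, |g z - g x| ≤ L * ‖z - x‖) (hB : ∀ z ∈ unitCube d, |g z| ≤ B)
    (hn : 0 < n) (q : (Fin n → EuclideanSpace ℝ (Fin d)) × (Fin n → ℝ)) :
    (kerfEstimate g k x q - g x) ^ 2 ≤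
      2 * biasBound L B k x q.1 + 2 * (∑ i, kerfWeight k x q.1 i * q.2 i) ^ 2 := by
  have hn' : (0 : ℝ) < n := by exact_mod_cast hn
  have hK := fun i => kerfKernel_nonneg k x (q.1 i)
  have h1 : kerfEstimate g k x q - g x =
      ((∑ i, g (q.1 i) * kerfKernel k x (q.1 i)) / (∑ i, kerfKernel k x (q.1 i)) - g x) +
        ∑ i, kerfWeight k x q.1 i * q.2 i := by
    have h2 : ∑ i, kerfWeight k x q.1 i * q.2 i =
        (∑ i, q.2 i * kerfKernel k x (q.1 i)) / ∑ i, kerfKernel k x (q.1 i) := by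
      rw [Finset.sum_div]
      exact Finset.sum_congr rfl fun i _ => by rw [kerfWeight]; ring
    rw [h2, kerfEstimate]
    simp_rw [add_mul, Finset.sum_add_distrib, add_div]
    ring
  have hbias : ((∑ i, g (q.1 i) * kerfKernel k x (q.1 i)) / (∑ i, kerfKernel k x (q.1 i))
      - g x) ^ 2 ≤ biasBound L B k x q.1 := by
    refine bias_sq_le hK (by positivity) (hB x hx) (fun i => ?_) (fun i => ?_)
    · by_cases h : kerfKernel k x (q.1 i) = 0
      · simp [h]
      · rw [mul_comm]
        refine mul_le_mul_of_nonneg_right ?_ (hK i)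
        have h2 := hB _ (mem_unitCube_of_kerfKernel_ne_zero h)
        have h3 := hB x hx
        have h4 := abs_sub (g (q.1 i)) (g x)
        linarith
    · by_cases h : kerfKernel k x (q.1 i) = 0
      · simp [h]
      · rw [mul_left_comm]
        exact mul_le_mul_of_nonneg_left (hL _ (mem_unitCube_of_kerfKernel_ne_zero h)) (hK i)
  rw [h1]
  refine add_sq_le.trans ?_
  linarith

lemma integrable_kernel_sum_sub_sq {x : EuclideanSpace ℝ (Fin d)} (hx : x ∈ unitCube d) (a : ℝ) :
    Integrable (fun X : Fin n → EuclideanSpace ℝ (Fin d) => (∑ i, kerfKernel k x (X i) - a) ^ 2)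
      (Measure.pi fun _ => volume.restrict (unitCube d)) :=
  ((memLp_sum_comp_eval (memLp_kerfKernel hx k 2)).sub (memLp_const a)).integrable_sq

lemma integrable_biasBound (L B : ℝ) {x : EuclideanSpace ℝ (Fin d)} (hx : x ∈ unitCube d) :
    Integrable (biasBound (n := n) L B k x)
      (Measure.pi fun _ => volume.restrict (unitCube d)) := by
  have h1 := (memLp_sum_comp_eval (n := n) (memLp_kerfKernel_mul_norm hx k 2)).integrable_sq
  have h2 := integrable_kernel_sum_sub_sq (n := n) (k := k) hx (n * (1 / 2) ^ k)
  exact ((h1.const_mul _).div_const _).add (((h2.const_mul _).div_const _).const_mul _)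

lemma integral_kernel_sum_sub_sq_le {x : EuclideanSpace ℝ (Fin d)} (hx : x ∈ unitCube d) :
    ∫ X, (∑ i, kerfKernel k x (X i) - n * (1 / 2) ^ k) ^ 2
      ∂(Measure.pi fun _ : Fin n => volume.restrict (unitCube d)) ≤ (n : ℝ) * (1 / 2) ^ k := by
  have h := integral_sum_comp_eval_sub_sq_le (n := n) (memLp_kerfKernel hx k 2)
  rw [integral_kerfKernel hx] at h
  exact h.trans (mul_le_mul_of_nonneg_left (integral_kerfKernel_sq_le hx k) (Nat.cast_nonneg n))

lemma integral_biasBound_le (L B : ℝ) {x : EuclideanSpace ℝ (Fin d)} (hx : x ∈ unitCube d)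
    (hn : 0 < n) :
    ∫ X, biasBound L B k x X ∂(Measure.pi fun _ : Fin n => volume.restrict (unitCube d)) ≤
      (4 * L ^ 2 * d ^ 2 + 16 * B ^ 2) * (2 ^ k / n + ((1 - 1 / (2 * d)) ^ k) ^ 2) := by
  have hn' : (0 : ℝ) < n := by exact_mod_cast hn
  -- `a` is the expected sum of the kernel over the sample; its inverse is the variance term `2 ^ k
  -- / n`.
  set a : ℝ := n * (1 / 2) ^ k with ha
  have ha0 : 0 < a := by positivity
  have hinv : (2 : ℝ) ^ k / n = 1 / a := by
    rw [ha, one_div_pow]; field_simp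
  have h1 := (memLp_sum_comp_eval (n := n) (memLp_kerfKernel_mul_norm hx k 2)).integrable_sq
  have h2 := integrable_kernel_sum_sub_sq (n := n) (k := k) hx a
  have h3 : ∫ X, (∑ i, kerfKernel k x (X i) * ‖X i - x‖) ^ 2
      ∂(Measure.pi fun _ : Fin n => volume.restrict (unitCube d)) ≤
      d ^ 2 * a + (a * (d * (1 - 1 / (2 * d)) ^ k)) ^ 2 := by
    refine (integral_sum_comp_eval_sq_le (memLp_kerfKernel_mul_norm hx k 2)).trans ?_
    refine add_le_add ?_ (pow_le_pow_left₀ ?_ ?_ 2)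
    · calc _ ≤ (n : ℝ) * (d ^ 2 * (1 / 2) ^ k) :=
            mul_le_mul_of_nonneg_left (integral_kerfKernel_mul_norm_sq_le hx k) hn'.le
        _ = _ := by rw [ha]; ring
    · exact mul_nonneg hn'.le (integral_nonneg fun z =>
        mul_nonneg (kerfKernel_nonneg _ _ _) (norm_nonneg _))
    · rw [ha, mul_assoc]
      exact mul_le_mul_of_nonneg_left (integral_kerfKernel_mul_norm_le hx k) hn'.le
  have h4 := integral_kernel_sum_sub_sq_le (n := n) (k := k) hx
  simp only [biasBound, ← ha]
  rw [integral_add ((h1.const_mul _).div_const _) (((h2.const_mul _).div_const _).const_mul _),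
    integral_div, integral_const_mul, integral_const_mul, integral_div, integral_const_mul, hinv]
  calc _ ≤ 4 * L ^ 2 * (d ^ 2 * a + (a * (d * (1 - 1 / (2 * d)) ^ k)) ^ 2) / a ^ 2 +
        4 * B ^ 2 * (4 * a / a ^ 2) := by gcongr
    _ = 4 * L ^ 2 * d ^ 2 * (1 / a + ((1 - 1 / (2 * d)) ^ k) ^ 2) + 16 * B ^ 2 * (1 / a) := by
        field_simp
        ring
    _ ≤ _ := by
        have : 0 ≤ 16 * B ^ 2 * ((1 - 1 / (2 * d) : ℝ) ^ k) ^ 2 := by positivity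
        linarith

lemma measurable_kerfWeight {x : EuclideanSpace ℝ (Fin d)} (hx : x ∈ unitCube d) (i : Fin n) :
    Measurable fun X : Fin n → EuclideanSpace ℝ (Fin d) => kerfWeight k x X i := by
  have hm := measurable_kerfKernel hx k
  unfold kerfWeight
  fun_prop

lemma integrable_noise_sq (σ : NNReal) :
    Integrable (fun e : Fin n → ℝ => ∑ i, e i ^ 2)
      (Measure.pi fun _ : Fin n => gaussianReal 0 (σ ^ 2)) :=
  integrable_finsetSum _ fun _ _ => integrable_comp_eval
    (μ := fun _ : Fin n => gaussianReal 0 (σ ^ 2)) (memLp_id_gaussianReal_two σ).integrable_sq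

/-- By Cauchy–Schwarz and `sum_sq_weights_le_one`, the squared weighted noise is dominated by the
sum of the squared noises. -/
lemma integrable_weighted_noise_sq (σ : NNReal) {x : EuclideanSpace ℝ (Fin d)}
    (hx : x ∈ unitCube d) :
    Integrable (fun q : (Fin n → EuclideanSpace ℝ (Fin d)) × (Fin n → ℝ) =>
        (∑ i, kerfWeight k x q.1 i * q.2 i) ^ 2)
      ((Measure.pi fun _ => volume.restrict (unitCube d)).prod
        (Measure.pi fun _ => gaussianReal 0 (σ ^ 2))) := by
  have hw := fun i => measurable_kerfWeight (n := n) (k := k) hx i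
  refine ((integrable_noise_sq σ).comp_snd _).mono'
    (by fun_prop : Measurable _).aestronglyMeasurable (.of_forall fun q => ?_)
  rw [Real.norm_of_nonneg (sq_nonneg _)]
  refine (Finset.sum_mul_sq_le_sq_mul_sq _ _ _).trans ?_
  exact mul_le_of_le_one_left (Finset.sum_nonneg fun i _ => sq_nonneg _)
    (sum_sq_weights_le_one fun i => kerfKernel_nonneg k x (q.1 i))

lemma integral_weighted_noise_sq_le (σ : NNReal) {x : EuclideanSpace ℝ (Fin d)}
    (hx : x ∈ unitCube d) (hn : 0 < n) :
    ∫ q, (∑ i, kerfWeight k x q.1 i * q.2 i) ^ 2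
      ∂((Measure.pi fun _ : Fin n => volume.restrict (unitCube d)).prod
        (Measure.pi fun _ : Fin n => gaussianReal 0 (σ ^ 2))) ≤ 8 * σ ^ 2 * (2 ^ k / n) := by
  have hn' : (0 : ℝ) < n := by exact_mod_cast hn
  set a : ℝ := n * (1 / 2) ^ k with ha
  have ha0 : 0 < a := by positivity
  have hinv : (2 : ℝ) ^ k / n = 1 / a := by
    rw [ha, one_div_pow]; field_simp
  -- For a fixed design the weights are constants, and the noise contributes `σ ^ 2` times the sum
  -- of their squares.
  rw [integral_prod _ (integrable_weighted_noise_sq σ hx)]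
  simp only [integral_sum_mul_gaussian_sq]
  rw [integral_const_mul, hinv]
  have h1 : Integrable (fun X : Fin n → EuclideanSpace ℝ (Fin d) =>
      ∑ i, kerfKernel k x (X i) ^ 2) (Measure.pi fun _ => volume.restrict (unitCube d)) :=
    integrable_finsetSum _ fun _ _ => integrable_comp_eval
      (μ := fun _ : Fin n => volume.restrict (unitCube d)) (memLp_kerfKernel hx k 2).integrable_sq
  have h2 := integrable_kernel_sum_sub_sq (n := n) (k := k) hx a
  have h3 : ∫ X, ∑ i, kerfKernel k x (X i) ^ 2
      ∂(Measure.pi fun _ : Fin n => volume.restrict (unitCube d)) ≤ a := by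
    rw [integral_sum_comp_eval (memLp_kerfKernel hx k 2).integrable_sq]
    exact mul_le_mul_of_nonneg_left (integral_kerfKernel_sq_le hx k) hn'.le
  have h4 := integral_kernel_sum_sub_sq_le (n := n) (k := k) hx
  have h5 : ∫ X, ∑ i, kerfWeight k x X i ^ 2
      ∂(Measure.pi fun _ : Fin n => volume.restrict (unitCube d)) ≤ 8 * (1 / a) := by
    calc _ ≤ ∫ X, (4 * (∑ i, kerfKernel k x (X i) ^ 2) / a ^ 2 +
          4 * (∑ i, kerfKernel k x (X i) - a) ^ 2 / a ^ 2)
          ∂(Measure.pi fun _ : Fin n => volume.restrict (unitCube d)) := by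
          refine integral_mono_of_nonneg
            (.of_forall fun X => Finset.sum_nonneg fun i _ => sq_nonneg _)
            (((h1.const_mul _).div_const _).add ((h2.const_mul _).div_const _))
            (.of_forall fun X => ?_)
          exact sum_sq_weights_le (fun i => kerfKernel_nonneg k x (X i)) ha0
      _ ≤ 4 * a / a ^ 2 + 4 * a / a ^ 2 := by
          rw [integral_add ((h1.const_mul _).div_const _) ((h2.const_mul _).div_const _),
            integral_div, integral_const_mul, integral_div, integral_const_mul]
          gcongr
      _ = 8 * (1 / a) := by field_simp; norm_num
  calc _ ≤ (σ : ℝ) ^ 2 * (8 * (1 / a)) := by gcongr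
    _ = _ := by ring

/-- The mean squared error of the infinite KeRF estimator at depth `k`. -/
lemma kerfEstimate_risk_le {g : EuclideanSpace ℝ (Fin d) → ℝ} (hg : Measurable g) {L B : ℝ}
    (σ : NNReal) {x : EuclideanSpace ℝ (Fin d)} (hx : x ∈ unitCube d)
    (hL : ∀ z ∈ unitCube d, |g z - g x| ≤ L * ‖z - x‖) (hB : ∀ z ∈ unitCube d, |g z| ≤ B)
    (hn : 0 < n) :
    Integrable (fun q => (kerfEstimate (n := n) g k x q - g x) ^ 2)
      ((Measure.pi fun _ => volume.restrict (unitCube d)).prod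
        (Measure.pi fun _ => gaussianReal 0 (σ ^ 2))) ∧
    ∫ q, (kerfEstimate (n := n) g k x q - g x) ^ 2
      ∂((Measure.pi fun _ => volume.restrict (unitCube d)).prod
        (Measure.pi fun _ => gaussianReal 0 (σ ^ 2))) ≤
      (8 * L ^ 2 * d ^ 2 + 32 * B ^ 2 + 16 * σ ^ 2) *
        (2 ^ k / n + ((1 - 1 / (2 * d)) ^ k) ^ 2) := by
  have hbound := kerfEstimate_sub_sq_le (k := k) hx hL hB hn
  have hi1 := ((integrable_biasBound (n := n) (k := k) L B hx).comp_fst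
    (Measure.pi fun _ : Fin n => gaussianReal 0 (σ ^ 2))).const_mul 2
  have hi2 := (integrable_weighted_noise_sq (n := n) (k := k) σ hx).const_mul 2
  have hm := measurable_kerfKernel hx k
  have hmeas : Measurable fun q => (kerfEstimate (n := n) g k x q - g x) ^ 2 := by
    unfold kerfEstimate
    fun_prop
  have hint := (hi1.add hi2).mono' hmeas.aestronglyMeasurable (.of_forall fun q => by
    rw [Real.norm_of_nonneg (sq_nonneg _)]
    exact hbound q)
  refine ⟨hint, (integral_mono hint (hi1.add hi2) hbound).trans ?_⟩
  have h1 := integral_biasBound_le (k := k) L B hx hn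
  have h2 := integral_weighted_noise_sq_le (k := k) σ hx hn
  have h3 : 0 ≤ 16 * (σ : ℝ) ^ 2 * ((1 - 1 / (2 * d) : ℝ) ^ k) ^ 2 := by positivity
  simp only [Pi.add_apply]
  rw [integral_add hi1 hi2, integral_const_mul, integral_const_mul,
    integral_fun_fst (fun X => biasBound L B k x X), probReal_univ, one_smul]
  linarith

end Risk

/-! ### Choice of the depth, and transfer to the regression sample. -/

/-- The two terms of the risk bound are balanced at depth `d log n / (1 + d log 2)`. -/
lemma risk_terms_le {d : ℕ} (hd : 0 < d) {n k : ℕ} (hn : 0 < n)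
    (hk : |(k : ℝ) - d * Real.log n / (1 + d * Real.log 2)| ≤ 1) :
    (2 : ℝ) ^ k / n + ((1 - 1 / (2 * d)) ^ k) ^ 2 ≤
      5 * (n : ℝ) ^ (-(1 / (1 + d * Real.log 2))) := by
  have hn' : (0 : ℝ) < n := by exact_mod_cast hn
  have hd' : (1 : ℝ) ≤ d := by exact_mod_cast hd
  have hlog2 : 0 < Real.log 2 := Real.log_pos one_lt_two
  have hD : 0 < 1 + d * Real.log 2 := by positivity
  rw [abs_le] at hk
  have h1 : (2 : ℝ) ^ k / n ≤ 2 * (n : ℝ) ^ (-(1 / (1 + d * Real.log 2))) := by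
    have h2 : (2 : ℝ) ^ k = Real.exp (k * Real.log 2) := by
      rw [Real.exp_nat_mul, Real.exp_log two_pos]
    rw [div_le_iff₀ hn', h2, Real.rpow_def_of_pos hn']
    -- At the ideal depth `2 ^ k / n` is exactly the target power of `n`; exceeding it by at most
    -- one level costs the factor `2`.
    calc Real.exp (k * Real.log 2)
        ≤ Real.exp (Real.log 2 + Real.log n * -(1 / (1 + d * Real.log 2)) + Real.log n) := by
          apply Real.exp_le_exp.2
          calc k * Real.log 2 ≤ (d * Real.log n / (1 + d * Real.log 2) + 1) * Real.log 2 := by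
                gcongr
                linarith [hk.2]
            _ = _ := by field_simp; ring
      _ = _ := by rw [Real.exp_add, Real.exp_add, Real.exp_log two_pos, Real.exp_log hn']
  have h3 : ((1 - 1 / (2 * d) : ℝ) ^ k) ^ 2 ≤
      3 * (n : ℝ) ^ (-(1 / (1 + d * Real.log 2))) := by
    have h4 : (1 - 1 / (2 * d) : ℝ) ≤ Real.exp (-(1 / (2 * d))) := by
      linarith [Real.add_one_le_exp (-(1 / (2 * d : ℝ)))]
    have h5 : 0 ≤ (1 - 1 / (2 * d) : ℝ) := by
      rw [sub_nonneg, div_le_one (by positivity)]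
      linarith
    rw [← pow_mul, Real.rpow_def_of_pos hn']
    calc (1 - 1 / (2 * d) : ℝ) ^ (k * 2) ≤ Real.exp (-(1 / (2 * d))) ^ (k * 2) := by gcongr
      _ = Real.exp (-k / d) := by
          rw [← Real.exp_nat_mul]
          congr 1
          push_cast
          field_simp
      -- At the ideal depth `exp (-k / d)` is again the target power; falling short by at most one
      -- level costs `exp (1 / d) ≤ exp 1 < 3`.
      _ ≤ Real.exp (1 + Real.log n * -(1 / (1 + d * Real.log 2))) := by
          apply Real.exp_le_exp.2
          rw [div_le_iff₀ (by positivity)]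
          have h6 : (1 + Real.log n * -(1 / (1 + d * Real.log 2))) * d =
              d - d * Real.log n / (1 + d * Real.log 2) := by
            field_simp
            ring
          linarith [hk.1]
      _ ≤ _ := by
          rw [Real.exp_add]
          gcongr
          linarith [Real.exp_one_lt_d9]
  linarith

/-- The design and the noise of a regression sample are independent of each other. -/
lemma IsRegressionSample.hasLaw_prod {Ω : Type*} [MeasurableSpace Ω] {P : Measure Ω}
    [IsProbabilityMeasure P] {d n : ℕ} [NeZero d]
    {m : EuclideanSpace ℝ (Fin d) → ℝ} {σ : NNReal} {X : Fin n → Ω → EuclideanSpace ℝ (Fin d)}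
    {ε Y : Fin n → Ω → ℝ} (h : IsRegressionSample P m σ X ε Y) :
    HasLaw (fun ω => ((fun i => X i ω), fun i => ε i ω))
      ((Measure.pi fun _ : Fin n => volume.restrict (unitCube d)).prod
        (Measure.pi fun _ : Fin n => gaussianReal 0 (σ ^ 2))) P := by
  have h1 : ∀ i, HasLaw (fun ω => (X i ω, ε i ω))
      ((volume.restrict (unitCube d)).prod (gaussianReal 0 (σ ^ 2))) P := fun i =>
    (h.indep_noise i).hasLaw_prod (h.law_X i) (h.law_noise i)
  exact (measurePreserving_arrowProdEquivProdArrow (EuclideanSpace ℝ (Fin d)) ℝ (Fin n)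
    (fun _ => volume.restrict (unitCube d)) fun _ => gaussianReal 0 (σ ^ 2)).fun_comp_hasLaw
      (h.indep.hasLaw_pi h1)

end

theorem mainTheorem2 (d : ℕ) (hd : 0 < d) (L σ : NNReal) (B : ℝ) :
    ∃ C : ℝ, 0 < C ∧
      ∀ (m : EuclideanSpace ℝ (Fin d) → ℝ), LipschitzOnWith L m (unitCube d) →
        (∀ x ∈ unitCube d, |m x| ≤ B) →
      ∀ (n : ℕ), 2 ≤ n →
      ∀ (Ω : Type*) [MeasurableSpace Ω] (P : Measure Ω) [IsProbabilityMeasure P]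
        (X : Fin n → Ω → EuclideanSpace ℝ (Fin d)) (ε Y : Fin n → Ω → ℝ),
        IsRegressionSample P m σ X ε Y →
      -- `Θ j l` is the coordinate chosen by the `j`-th directional tree for its level `l`
      ∀ (Θ : ℕ → ℕ → Ω → Fin d),
        IsIIDUniformCoords P (fun q : ℕ × ℕ => Θ q.1 q.2) →
      ∀ (k : ℕ),
        -- almost surely, the infinite directional KeRF exists as a limit
        (∀ᵐ ω ∂P, ∀ x ∈ unitCube d,
          Tendsto (fun M : ℕ => finiteKeRF M (fun j => directionalTree (fun l => Θ j l ω)) k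
              (fun i => X i ω) (fun i => Y i ω) x) atTop
            (𝓝 (infiniteKeRF (fun j => directionalTree (fun l => Θ j l ω)) k
              (fun i => X i ω) (fun i => Y i ω) x))) ∧
        -- it coincides with the infinite centered KeRF, whose `j`-th tree chooses for each
        -- node `v` separately a coordinate `Ψ j v`
        (∀ (Ψ : ℕ → List Bool → Ω → Fin d),
          IsIIDUniformCoords P (fun q : ℕ × List Bool => Ψ q.1 q.2) →
          ∀ᵐ ω ∂P, ∀ x ∈ unitCube d,
            Tendsto (fun M : ℕ => finiteKeRF M (fun j v => Ψ j v ω) k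
                (fun i => X i ω) (fun i => Y i ω) x) atTop
              (𝓝 (infiniteKeRF (fun j v => Ψ j v ω) k (fun i => X i ω) (fun i => Y i ω) x)) ∧
            infiniteKeRF (fun j => directionalTree (fun l => Θ j l ω)) k
                (fun i => X i ω) (fun i => Y i ω) x =
              infiniteKeRF (fun j v => Ψ j v ω) k (fun i => X i ω) (fun i => Y i ω) x) ∧
        -- the rate, for depth `d log n / (1 + d log 2)` up to rounding
        (|(k : ℝ) - d * Real.log n / (1 + d * Real.log 2)| ≤ 1 →
          ∀ x ∈ unitCube d,
            Integrable (fun ω => (infiniteKeRF (fun j => directionalTree (fun l => Θ j l ω)) k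
              (fun i => X i ω) (fun i => Y i ω) x - m x) ^ 2) P ∧
            ∫ ω, (infiniteKeRF (fun j => directionalTree (fun l => Θ j l ω)) k
              (fun i => X i ω) (fun i => Y i ω) x - m x) ^ 2 ∂P ≤
              C * (n : ℝ) ^ (-(1 / (1 + d * Real.log 2))) * Real.log n) := by

  have : NeZero d := ⟨hd.ne'⟩
  have hlog2 : 0 < Real.log 2 := Real.log_pos one_lt_two
  have hA : (0 : ℝ) ≤ 8 * (L : ℝ) ^ 2 * d ^ 2 + 32 * B ^ 2 + 16 * (σ : ℝ) ^ 2 := by positivity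
  -- The summand `1` keeps the constant positive when `L`, `B` and `σ` all vanish.
  refine ⟨5 * (8 * (L : ℝ) ^ 2 * d ^ 2 + 32 * B ^ 2 + 16 * (σ : ℝ) ^ 2) / Real.log 2 + 1,
    by positivity, ?_⟩
  intro m hm hmB n hn Ω _ P _ X ε Y hXY Θ hΘ k
  have hpaths := ae_hasUniformPaths_directional hΘ k
  refine ⟨?_, ?_, ?_⟩
  · filter_upwards [hpaths] with ω hω x hx
    rw [hω.infiniteKeRF_eq _ _ hx]
    exact hω.tendsto_finiteKeRF _ _ hx
  · intro Ψ hΨ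
    filter_upwards [hpaths, ae_hasUniformPaths_centered hΨ k] with ω hω hω' x hx
    rw [hω.infiniteKeRF_eq _ _ hx, hω'.infiniteKeRF_eq _ _ hx]
    exact ⟨hω'.tendsto_finiteKeRF _ _ hx, rfl⟩
  · intro hk x hx
    have hn0 : 0 < n := by omega
    -- Off the cube `m` is arbitrary, perhaps not measurable. A Lipschitz extension `g` of its
    -- restriction replaces it, since almost surely all `X i` lie in the cube.
    obtain ⟨g, hgL, hgm⟩ := hm.extend_real
    obtain ⟨hint, hrisk⟩ := kerfEstimate_risk_le (k := k) hgL.continuous.measurable (L := L) (B := B)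
      σ hx (fun z _ => by simpa [Real.dist_eq, dist_eq_norm] using hgL.dist_le_mul z x)
      (fun z hz => by rw [← hgm hz]; exact hmB z hz) hn0
    have hlaw := hXY.hasLaw_prod
    have hcube : ∀ᵐ ω ∂P, ∀ i, X i ω ∈ unitCube d := ae_all_iff.2 fun i =>
      ae_of_ae_map (hXY.law_X i).aemeasurable <| by
        rw [(hXY.law_X i).map_eq]
        exact ae_restrict_mem measurableSet_unitCube
    have heq : (fun ω => (infiniteKeRF (fun j => directionalTree (fun l => Θ j l ω)) k
          (fun i => X i ω) (fun i => Y i ω) x - m x) ^ 2) =ᵐ[P]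
        (fun q => (kerfEstimate g k x q - g x) ^ 2) ∘
          fun ω => ((fun i => X i ω), fun i => ε i ω) := by
      filter_upwards [hpaths, hcube, ae_all_iff.2 hXY.eq_Y] with ω hω hc hY
      rw [hω.infiniteKeRF_eq _ _ hx]
      simp only [kerfEstimate, Function.comp_apply, hY, hgm hx, fun i => hgm (hc i)]
    rw [← hlaw.map_eq] at hint
    refine ⟨(hint.comp_aemeasurable hlaw.aemeasurable).congr heq.symm, ?_⟩
    rw [integral_congr_ae heq, hlaw.integral_comp (by
      rw [← hlaw.map_eq]; exact hint.aestronglyMeasurable)]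
    refine hrisk.trans ((mul_le_mul_of_nonneg_left (risk_terms_le hd hn0 hk) hA).trans ?_)
    have hr : 0 ≤ (n : ℝ) ^ (-(1 / (1 + d * Real.log 2))) := by positivity
    -- The risk bound obtained so far has no logarithm; the factor `log n / log 2 ≥ 1` is inserted
    -- using `2 ≤ n`.
    have hlogn : Real.log 2 ≤ Real.log n :=
      Real.log_le_log two_pos (by exact_mod_cast hn)
    have h1 : 1 ≤ Real.log n / Real.log 2 := by rwa [one_le_div hlog2]
    calc _ ≤ (8 * (L : ℝ) ^ 2 * d ^ 2 + 32 * B ^ 2 + 16 * (σ : ℝ) ^ 2) *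
          (5 * (n : ℝ) ^ (-(1 / (1 + d * Real.log 2)))) * (Real.log n / Real.log 2) :=
          le_mul_of_one_le_right (by positivity) h1
      _ = (5 * (8 * (L : ℝ) ^ 2 * d ^ 2 + 32 * B ^ 2 + 16 * (σ : ℝ) ^ 2) / Real.log 2) *
          (n : ℝ) ^ (-(1 / (1 + d * Real.log 2))) * Real.log n := by ring
      _ ≤ _ := by
          have hlogn0 : 0 ≤ Real.log n := hlog2.le.trans hlogn
          gcongr
          linarith
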